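/- **Setting.** Let $\mathcal D$ be a probability distribution on $[0,\infty)$ with $0<\mathbb E[\mathcal D]<\infty$, let $n\ge 1$, and let $\boldsymbol\sigma=(\sigma_1,\dots,\sigma_n)\in\mathbb R_{\ge 0}^n$. Box $i$ contains a hidden reward $X_i$; $X_1,\dots,X_n$ are i.i.d. from $\mathcal D$. One observes $Y_i=X_i+\epsilon_i$, where the $\epsilon_i$ are normal with mean $0$ and standard deviation $\sigma_i$ ($\epsilon_i=0$ if $\sigma_i=0$), and all $X_i,\epsilon_i$ are independent. A policy $A$ maps $(\boldsymbol\sigma,\boldsymbol y)$ to a probability distribution over the boxes; $R_A(\mathcal D,\boldsymbol\sigma)$ is the expected reward of the selected box. $\mathsf{Naive}$ is a policy that always selects a box with the largest observation $y_i$, with an arbitrary (possibly randomized) tie-breaking rule. The optimal policy knows $\mathcal D$ and selects the box with the largest posterior expectation, so $R_{\mathsf{Opt}_{\mathcal D}}(\mathcal D,\boldsymbol\sigma)=\mathbb E\big[\max_i \mathbb E[X_i\mid Y_i]\big]$. $\mathcal D_{k:k}$ denotes the maximum of $k$ i.i.d. draws from $\mathcal D$. For $c\in(0,1]$, the *small-noise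 set* for $(\mathcal D,n,c)$ is the set of $\boldsymbol\sigma\in\mathbb R_{\ge0}^n$ with $\sigma_1\le\dots\le\sigma_n$ such that at least $cn$ of the values $\sigma_i$ are at most $\dfrac{\mathbb E[\mathcal D_{\lceil cn\rceil:\lceil cn\rceil}]}{5\sqrt{2\ln n}}$. For a random variable $Z\ge0$ of finite mean and $m>0$, let $\beta_m^{(Z)}=\inf\{x : \mathbb E[Z\,\mathbf 1_{Z\ge x}]\le \mathbb E[Z]/m\}$. **Theorem.** (1) For every such $\mathcal D$, every integer $n\ge 46$ and every $c$ with $0<c\le \frac{n-6\ln n}{n}$, there is $\boldsymbol\sigma^*$ in the small-noise set for $(\mathcal D,n,c)$ such that, for every tie-breaking rule of $\mathsf{Naive}$, $$R_{\mathsf{Naive}}(\mathcal D,\boldsymbol\sigma^*)\le \frac{8\,\mathbb E[\mathcal D]}{\mathbb E[\mathcal D_{n:n}]}\cdot R_{\mathsf{Opt}_{\mathcal D}}(\mathcal D,\boldsymbol\sigma^*).$$ Moreover $\boldsymbol\sigma^*$ can be taken as follows: $\sigma^*_i=0$ for $i\le n-\lfloor 6\ln n\rfloor$, and $\sigma^*_i=6\,\beta_{n^2}^{(\mathcal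 D_{n:n})}\sqrt{\ln n}>0$ for the remaining $i$. In particular the number of noisy boxes lies between $5\ln n$ and $6\ln n$. (2) Consequently, $\mathsf{Naive}$ can be a factor $\Omega(n)$ worse than optimal: there is an absolute constant $\kappa>0$ such that for every $n\ge 46$ and every $c$ with $0<c\le\frac{n-6\ln n}{n}$ there are such a distribution $\mathcal D$ and a $\boldsymbol\sigma^*$ in the small-noise set for $(\mathcal D,n,c)$ with, for every tie-breaking rule of $\mathsf{Naive}$, $$R_{\mathsf{Naive}}(\mathcal D,\boldsymbol\sigma^*)>0\quad\text{and}\quad R_{\mathsf{Opt}_{\mathcal D}}(\mathcal D,\boldsymbol\sigma^*)\ge \kappa\, n\, R_{\mathsf{Naive}}(\mathcal D,\boldsymbol\sigma^*).$$ -/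

import Mathlib

open MeasureTheory ProbabilityTheory
open scoped NNReal

noncomputable section

namespace NoisyBoxes

/-- `𝔼[𝒟]`. -/
def mean (D : Measure ℝ) : ℝ := ∫ x, x ∂D

/-- The law of `𝒟_{k:k}`, the maximum of `k` i.i.d. draws from `𝒟`. -/
def maxLaw (D : Measure ℝ) (k : ℕ) : Measure ℝ :=
  (Measure.pi fun _ : Fin k => D).map fun x => ⨆ i, x i

/-- Joint law of the rewards `x` (i.i.d. from `𝒟`) and the independent noises `ε`, where `ε i` is
centred normal with standard deviation `σ i` (the point mass at `0` if `σ i = 0`).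
A sample point is `ω = (x, ε)`. -/
def jointLaw (D : Measure ℝ) {n : ℕ} (σ : Fin n → ℝ≥0) : Measure ((Fin n → ℝ) × (Fin n → ℝ)) :=
  (Measure.pi fun _ : Fin n => D).prod (Measure.pi fun i => gaussianReal 0 (σ i ^ 2))

/-- The hidden reward `X i`. -/
def reward {n : ℕ} (i : Fin n) (ω : (Fin n → ℝ) × (Fin n → ℝ)) : ℝ := ω.1 i

/-- The observation `Y i = X i + ε i`. -/
def obs {n : ℕ} (i : Fin n) (ω : (Fin n → ℝ) × (Fin n → ℝ)) : ℝ := ω.1 i + ω.2 i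

/-- A policy maps the public information `(σ, y)` to a distribution over the boxes. -/
structure Policy (n : ℕ) where
  choice : (Fin n → ℝ≥0) → (Fin n → ℝ) → PMF (Fin n)
  measurable_choice : ∀ σ i, Measurable fun y => choice σ y i

/-- `R_A(𝒟, σ)`: the expected reward of the policy `A`, over rewards, noises and the randomness
of `A`. -/
def Policy.expectedReward {n : ℕ} (A : Policy n) (D : Measure ℝ) (σ : Fin n → ℝ≥0) : ℝ :=
  ∫ ω, ∑ i, (A.choice σ (fun j => obs j ω) i).toReal * reward i ω ∂(jointLaw D σ)

/-- A naive policy always selects a box with the largest observation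
(ties may be broken in any way, also at random). -/
def Policy.IsNaive {n : ℕ} (A : Policy n) : Prop :=
  ∀ σ y, ∀ i ∈ (A.choice σ y).support, ∀ j, y j ≤ y i

/-- `R_Opt(𝒟, σ) = 𝔼[max_i 𝔼[X i | Y i]]`: the expected reward of the policy that knows `𝒟` and
selects the box with the largest posterior expectation. -/
def optReward (D : Measure ℝ) {n : ℕ} (σ : Fin n → ℝ≥0) : ℝ :=
  ∫ ω, ⨆ i : Fin n, ((jointLaw D σ)[reward i | MeasurableSpace.comap (obs i) inferInstance]) ω
    ∂(jointLaw D σ)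

/-- The small-noise set for `(𝒟, n, c)`: nondecreasing noise vectors in which at least `c n` entries
are at most `𝔼[𝒟_{cn:cn}] / (5 √(2 ln n))`, where `cn` is rounded up in the order statistic.
For nondecreasing `σ` this says that the entry of (one-based) index `⌈c n⌉` is at most that bound. -/
def smallNoise (D : Measure ℝ) (n : ℕ) (c : ℝ) : Set (Fin n → ℝ≥0) :=
  {σ | Monotone σ ∧
    c * n ≤ (Finset.univ.filter fun i : Fin n =>
      (σ i : ℝ) ≤ mean (maxLaw D ⌈c * n⌉₊) / (5 * √(2 * Real.log n))).card}

/-- `β_m` of a law `μ`: the smallest threshold such that the values at least this threshold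
contribute at most `𝔼[μ] / m` to the expectation; note that
`𝔼[Z | Z ≥ x] · Pr[Z ≥ x] = ∫_{[x, ∞)} t dμ(t)`. -/
def tailThreshold (μ : Measure ℝ) (m : ℝ) : ℝ :=
  sInf {x | ∫ t in Set.Ici x, t ∂μ ≤ mean μ / m}

/-- The noise level `6 β √(ln n)` of the noisy boxes, with `β = β_{n²}` of `𝒟_{n:n}`. -/
def largeNoise (D : Measure ℝ) (n : ℕ) : ℝ :=
  6 * tailThreshold (maxLaw D n) ((n : ℝ) ^ 2) * √(Real.log n)

end NoisyBoxes

end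

/-! ### Gaussian estimates: symmetric competition, small shifts, lower tail. -/

section Gaussian

open Filter Set Topology

/-! Make k = ⌊6 ln n⌋ boxes so noisy that the largest observation is almost surely decided by noise,
and keep the other boxes exact. The naive policy then earns O(𝔼[𝒟]), while the optimal one can still
take the best exact box.

Let β = β_{n²} of 𝒟_{n:n}, and let the noise have variance 36 β² ln n. The naive reward has three
sources (`Policy.IsNaive.sum_le`). Outcomes whose largest reward exceeds β contribute at most
𝔼[𝒟_{n:n}]/n² ≤ 𝔼[𝒟]. Otherwise an exact box wins only if every noise is at most β, which has
probability at most (2/3)^k ≤ 1/n independently of the rewards; over n boxes this costs at most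
𝔼[𝒟]. A noisy box with reward x ≤ β wins only if its noise, shifted by x, beats the k - 1 other
noises. Without the shift this has probability 1/k by symmetry; the shift is so small relative to
the variance that the bound becomes e^{1/4}(1/k + 1/n) (`integral_gaussian_cdf_pow_shift_le`).
Summing over k boxes, the total is below 4 𝔼[𝒟].

For n ≥ 46 at least half of the boxes are exact, so the optimum is at least 𝔼[𝒟_{n:n}]/2. This gives
the factor 8. A Bernoulli law of mean 1/n has 𝔼[𝒟_{n:n}] ≥ 1/2, so the gap is linear in n. -/

lemma integral_gaussian_cdf_pow (m : ℝ) {v : ℝ≥0} (hv : v ≠ 0) (k : ℕ) :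
    ∫ y, ((gaussianReal m v).real (Iic y)) ^ k ∂(gaussianReal m v) = 1 / ((k : ℝ) + 1) := by
  set γ := gaussianReal m v with hγ
  have hint : Integrable (gaussianPDFReal m v) := integrable_gaussianPDFReal m v
  have hcont : Continuous (gaussianPDFReal m v) := by
    rw [gaussianPDFReal_def]; fun_prop
  have hreal : ∀ s : Set ℝ, γ.real s = ∫ t in s, gaussianPDFReal m v t := fun s => by
    rw [hγ, measureReal_def, gaussianReal_apply_eq_integral m hv, ENNReal.toReal_ofReal]
    exact integral_nonneg fun t => gaussianPDFReal_nonneg _ _ _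
  have hF : ∀ y, γ.real (Iic y)
      = (∫ t in Iic (0 : ℝ), gaussianPDFReal m v t) + ∫ t in (0 : ℝ)..y, gaussianPDFReal m v t := by
    intro y
    rw [hreal, ← intervalIntegral.integral_Iic_sub_Iic hint.integrableOn hint.integrableOn]
    ring
  have hderiv : ∀ y, HasDerivAt (fun y => γ.real (Iic y)) (gaussianPDFReal m v y) y := by
    intro y
    simp_rw [hF]
    exact (intervalIntegral.integral_hasDerivAt_right (hcont.intervalIntegrable _ _)
      hcont.stronglyMeasurable.stronglyMeasurableAtFilter hcont.continuousAt).const_add _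
  have hcdf : (fun y => γ.real (Iic y)) = cdf γ := by
    ext y; rw [cdf_eq_real]
  -- With F the distribution function, (k + 1) F^k F' is the derivative of F^(k+1), which runs from
  -- 0 to 1.
  have hpow : ∀ y, HasDerivAt (fun y => γ.real (Iic y) ^ (k + 1))
      (((k : ℝ) + 1) * γ.real (Iic y) ^ k * gaussianPDFReal m v y) y := by
    intro y
    have h := (hderiv y).fun_pow (k + 1)
    simpa using h
  have hmeas : Continuous (fun y => γ.real (Iic y)) :=
    continuous_iff_continuousAt.2 fun y => (hderiv y).continuousAt
  have hI : Integrable (fun y => ((k : ℝ) + 1) * γ.real (Iic y) ^ k * gaussianPDFReal m v y) := by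
    refine hint.bdd_mul (c := (k : ℝ) + 1)
      (continuous_const.mul (hmeas.pow k)).aestronglyMeasurable (Eventually.of_forall fun y => ?_)
    have h0 : 0 ≤ γ.real (Iic y) := measureReal_nonneg
    have h1 : γ.real (Iic y) ≤ 1 := measureReal_le_one
    rw [Real.norm_of_nonneg (by positivity)]
    exact mul_le_of_le_one_right (by positivity) (pow_le_one₀ h0 h1)
  have key := integral_of_hasDerivAt_of_tendsto hpow hI (m := (0 : ℝ) ^ (k + 1))
    (n := (1 : ℝ) ^ (k + 1))
    (Tendsto.pow (by rw [hcdf]; exact tendsto_cdf_atBot γ) _)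
    (Tendsto.pow (by rw [hcdf]; exact tendsto_cdf_atTop γ) _)
  have hk : ((k : ℝ) + 1) ≠ 0 := by positivity
  conv_lhs => rw [hγ]
  rw [integral_gaussianReal_eq_integral_smul hv, eq_div_iff hk, mul_comm, ← integral_const_mul]
  simp only [smul_eq_mul, ne_eq, Nat.add_eq_zero_iff, one_ne_zero, and_false, not_false_eq_true,
    zero_pow, one_pow, sub_zero] at key ⊢
  refine Eq.trans ?_ key
  congr 1; ext y; ring

/-- The left side bounds the density ratio of a normal shifted by x to the centred one, at variance
36β²L. When the exponent u exceeds 1/4, u - 1/4 ≤ 6L(u - 1/4) ≤ y/(6β) - 3L/2. The resulting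
correction has expectation only exp(-L). -/
lemma exp_shift_le {β L x y : ℝ} (hβ : 0 < β) (hL : 1 ≤ L) (hx0 : 0 ≤ x) (hxβ : x ≤ β) :
    Real.exp (x * y / (36 * β ^ 2 * L))
      ≤ Real.exp (1 / 4) * (1 + Real.exp (y / (6 * β) - 3 / 2 * L)) := by
  have hden : 0 < 36 * β ^ 2 * L := by positivity
  by_cases h : x * y / (36 * β ^ 2 * L) ≤ 1 / 4
  · exact (Real.exp_le_exp.2 h).trans
      (le_mul_of_one_le_right (by positivity) (by linarith [Real.exp_pos (y / (6 * β) - 3 / 2 * L)]))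
  · push Not at h
    have hxy : 0 < x * y := by
      by_contra hneg
      push Not at hneg
      have := div_nonpos_of_nonpos_of_nonneg hneg hden.le
      linarith
    have hy : 0 < y := by
      by_contra hneg
      push Not at hneg
      nlinarith
    have h1 : x * y / (36 * β ^ 2 * L) * (6 * L) ≤ y / (6 * β) := by
      have : x * y / (36 * β ^ 2 * L) * (6 * L) = (x / β) * (y / (6 * β)) := by
        field_simp; ring
      rw [this]
      exact mul_le_of_le_one_left (by positivity) ((div_le_one hβ).2 hxβ)
    have h2 : x * y / (36 * β ^ 2 * L) ≤ 1 / 4 + (y / (6 * β) - 3 / 2 * L) := by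
      nlinarith
    calc _ ≤ Real.exp (1 / 4 + (y / (6 * β) - 3 / 2 * L)) := Real.exp_le_exp.2 h2
      _ = Real.exp (1 / 4) * Real.exp (y / (6 * β) - 3 / 2 * L) := Real.exp_add _ _
      _ ≤ _ := by gcongr; linarith

/-- Shifting one of `k + 1` i.i.d. centred normals of large variance by a small amount barely
changes the probability that it is the largest one. -/
lemma integral_gaussian_cdf_pow_shift_le {β L x : ℝ} (hβ : 0 < β) (hL : 1 ≤ L) (hx0 : 0 ≤ x)
    (hxβ : x ≤ β) {v : ℝ≥0} (hv : (v : ℝ) = 36 * β ^ 2 * L) (k : ℕ) :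
    ∫ e, ((gaussianReal 0 v).real (Iic (x + e))) ^ k ∂(gaussianReal 0 v)
      ≤ Real.exp (1 / 4) * (1 / ((k : ℝ) + 1) + Real.exp (-L)) := by
  have hvpos : 0 < (v : ℝ) := by rw [hv]; positivity
  have hv0 : v ≠ 0 := fun h => by simp [h] at hvpos
  set γ := gaussianReal 0 v with hγ
  set f : ℝ → ℝ := fun y => γ.real (Iic y) ^ k with hf
  have hmono : Monotone fun y => γ.real (Iic y) := fun a b hab =>
    measureReal_mono (Iic_subset_Iic.2 hab)
  have hfm : Measurable f := hmono.measurable.pow_const k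
  have hf0 : ∀ y, 0 ≤ f y := fun y => pow_nonneg measureReal_nonneg _
  have hf1 : ∀ y, f y ≤ 1 := fun y => pow_le_one₀ measureReal_nonneg measureReal_le_one
  have hfi : ∀ μ : Measure ℝ, IsProbabilityMeasure μ → Integrable f μ := fun μ _ =>
    Integrable.of_bound hfm.aestronglyMeasurable 1
      (Eventually.of_forall fun y => by rw [Real.norm_of_nonneg (hf0 y)]; exact hf1 y)
  have hexp : Integrable (fun y => Real.exp (y / (6 * β) - 3 / 2 * L)) γ := by
    have := (integrable_exp_mul_gaussianReal (μ := 0) (v := v) (1 / (6 * β))).mul_const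
      (Real.exp (-(3 / 2 * L)))
    refine this.congr (Eventually.of_forall fun y => ?_)
    simp only [← Real.exp_add]
    congr 1; ring
  -- The moment generating function at 1/(6β) is exp(v/(72β²)) = exp(L/2), and L/2 - 3L/2 = -L.
  have hexpval : ∫ y, Real.exp (y / (6 * β) - 3 / 2 * L) ∂γ = Real.exp (-L) := by
    have h1 := mgf_gaussianReal (p := γ) (X := id) (μ := 0) (v := v) (by simp [hγ]) (1 / (6 * β))
    simp only [mgf, id] at h1
    have h2 : ∀ y : ℝ, Real.exp (y / (6 * β) - 3 / 2 * L)
        = Real.exp (1 / (6 * β) * y) * Real.exp (-(3 / 2 * L)) := fun y => by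
      rw [← Real.exp_add]; congr 1; ring
    simp_rw [h2]
    rw [integral_mul_const, h1, ← Real.exp_add, hv]
    congr 1; field_simp; ring
  have hshift : ∫ e, γ.real (Iic (x + e)) ^ k ∂γ = ∫ y, f y ∂(gaussianReal x v) := by
    have := gaussianReal_map_const_add (μ := 0) (v := v) x
    rw [zero_add] at this
    rw [← this, integral_map (by fun_prop) hfm.aestronglyMeasurable]
  have hpdf : ∀ y, gaussianPDFReal x v y
      ≤ gaussianPDFReal 0 v y * (Real.exp (1 / 4) * (1 + Real.exp (y / (6 * β) - 3 / 2 * L))) := by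
    intro y
    have h1 : gaussianPDFReal x v y
        = gaussianPDFReal 0 v y * (Real.exp (x * y / v) * Real.exp (-(x ^ 2 / (2 * v)))) := by
      simp only [gaussianPDFReal, mul_assoc, ← Real.exp_add]
      congr 2; field_simp; ring
    rw [h1]
    refine mul_le_mul_of_nonneg_left ?_ (gaussianPDFReal_nonneg _ _ _)
    calc _ ≤ Real.exp (x * y / v) := mul_le_of_le_one_right (by positivity)
            (Real.exp_le_one_iff.2 (neg_nonpos.2 (by positivity)))
      _ ≤ _ := by rw [hv]; exact exp_shift_le hβ hL hx0 hxβ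
  have hint1 : Integrable (fun y => gaussianPDFReal x v y • f y) := by
    refine (integrable_gaussianPDFReal x v).mul_bdd (c := 1) hfm.aestronglyMeasurable
      (Eventually.of_forall fun y => ?_)
    rw [Real.norm_of_nonneg (hf0 y)]; exact hf1 y
  have hb : Integrable (fun y => Real.exp (1 / 4) *
      (f y + Real.exp (y / (6 * β) - 3 / 2 * L))) γ := ((hfi γ inferInstance).add hexp).const_mul _
  have hint2 : Integrable (fun y => gaussianPDFReal 0 v y •
      (Real.exp (1 / 4) * (f y + Real.exp (y / (6 * β) - 3 / 2 * L)))) := by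
    rw [hγ, gaussianReal_of_var_ne_zero _ hv0, gaussianPDF_def,
      integrable_withDensity_iff_integrable_smul' (by fun_prop) (by simp)] at hb
    refine hb.congr (Eventually.of_forall fun y => ?_)
    simp only
    rw [ENNReal.toReal_ofReal (gaussianPDFReal_nonneg _ _ _)]
  rw [hshift, integral_gaussianReal_eq_integral_smul hv0]
  calc ∫ y, gaussianPDFReal x v y • f y
      ≤ ∫ y, gaussianPDFReal 0 v y •
          (Real.exp (1 / 4) * (f y + Real.exp (y / (6 * β) - 3 / 2 * L))) := by
        refine integral_mono hint1 hint2 fun y => ?_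
        simp only [smul_eq_mul]
        calc _ ≤ gaussianPDFReal 0 v y *
              (Real.exp (1 / 4) * (1 + Real.exp (y / (6 * β) - 3 / 2 * L))) * f y :=
              mul_le_mul_of_nonneg_right (hpdf y) (hf0 y)
          _ = gaussianPDFReal 0 v y *
              (Real.exp (1 / 4) * (f y + Real.exp (y / (6 * β) - 3 / 2 * L) * f y)) := by ring
          _ ≤ _ := by
              refine mul_le_mul_of_nonneg_left ?_ (gaussianPDFReal_nonneg _ _ _)
              gcongr
              exact mul_le_of_le_one_right (Real.exp_pos _).le (hf1 y)
    _ = ∫ y, Real.exp (1 / 4) * (f y + Real.exp (y / (6 * β) - 3 / 2 * L)) ∂γ := by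
        rw [hγ, integral_gaussianReal_eq_integral_smul hv0]
    _ = _ := by
        rw [integral_const_mul, integral_add (hfi γ inferInstance) hexp, hexpval,
          integral_gaussian_cdf_pow 0 hv0]

/-- A centred normal is at most `t` with probability at most `2 / 3` when `t` is at most a sixth of
the standard deviation. -/
lemma gaussianReal_Iic_le {t s : ℝ} (ht : 0 ≤ t) (hts : 6 * t ≤ s) (hs : 0 < s) {v : ℝ≥0}
    (hv : (v : ℝ) = s ^ 2) : (gaussianReal 0 v).real (Iic t) ≤ 2 / 3 := by
  have hvpos : 0 < (v : ℝ) := by rw [hv]; positivity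
  have hv0 : v ≠ 0 := fun h => by simp [h] at hvpos
  set γ := gaussianReal 0 v with hγ
  have : NullSingletonClass γ := nullSingletonClass_gaussianReal hv0
  -- By symmetry each half-line has mass 1/2; the stretch from 0 to t adds at most 1/6, the density
  -- being at most 1/s.
  have hneg : γ.real (Ioi 0) = γ.real (Iic 0) := by
    have h1 : γ.map (fun x => -x) = γ := by
      rw [hγ, gaussianReal_map_neg, neg_zero]
    conv_lhs => rw [← h1]
    rw [map_measureReal_apply (by fun_prop) measurableSet_Ioi]
    have : (fun x : ℝ => -x) ⁻¹' Ioi 0 = Iio 0 := by ext; simp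
    rw [this, measureReal_def, measureReal_def, measure_congr Iio_ae_eq_Iic]
  have hsum : γ.real (Iic 0) + γ.real (Ioi 0) = 1 := by
    have := measureReal_add_measureReal_compl (μ := γ) (measurableSet_Iic (a := (0 : ℝ)))
    rwa [compl_Iic, probReal_univ] at this
  have hIoc : γ.real (Ioc 0 t) ≤ 1 / 6 := by
    have hb : ∀ y, gaussianPDFReal 0 v y ≤ 1 / s := fun y => by
      rw [gaussianPDFReal, hv]
      have h2 : s ≤ √(2 * Real.pi * s ^ 2) := by
        refine Real.le_sqrt_of_sq_le ?_
        nlinarith [Real.pi_gt_three, sq_nonneg s]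
      calc _ ≤ (√(2 * Real.pi * s ^ 2))⁻¹ := mul_le_of_le_one_right (by positivity)
            (Real.exp_le_one_iff.2 (div_nonpos_of_nonpos_of_nonneg
              (neg_nonpos.2 (sq_nonneg _)) (by positivity)))
        _ ≤ 1 / s := by rw [one_div]; exact inv_anti₀ hs h2
    rw [hγ, measureReal_def, gaussianReal_apply_eq_integral 0 hv0, ENNReal.toReal_ofReal
      (integral_nonneg fun t => gaussianPDFReal_nonneg _ _ _)]
    calc ∫ y in Ioc 0 t, gaussianPDFReal 0 v y ≤ ∫ y in Ioc 0 t, 1 / s :=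
          integral_mono (integrable_gaussianPDFReal 0 v).integrableOn (by simp) hb
      _ = t / s := by simp [ht, div_eq_mul_inv]
      _ ≤ 1 / 6 := by rw [div_le_div_iff₀ hs (by norm_num)]; linarith
  have hun : γ.real (Iic t) ≤ γ.real (Iic 0) + γ.real (Ioc 0 t) := by
    rw [← Iic_union_Ioc_eq_Iic ht]
    exact measureReal_union_le _ _
  linarith

end Gaussian

/-! ### The tail threshold and numerical inequalities. -/

namespace NoisyBoxes

open Filter Set Topology

/-- The threshold `β_m` is positive, and the values above it contribute at most `𝔼 / m`. -/
lemma tailThreshold_spec {μ : Measure ℝ} (hμ0 : μ (Iio 0) = 0)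
    (hμ : Integrable (fun x : ℝ => x) μ) (hmean : 0 < mean μ) {m : ℝ} (hm : 1 < m) :
    0 < tailThreshold μ m ∧ ∫ t in Ioi (tailThreshold μ m), t ∂μ ≤ mean μ / m := by
  have hnn : ∀ᵐ x ∂μ, 0 ≤ x := by
    rw [ae_iff]; simpa [Iio] using hμ0
  set f : ℝ → ℝ := fun x => ∫ t in Ici x, t ∂μ with hf
  have hanti : Antitone f := fun a b hab =>
    setIntegral_mono_set hμ.integrableOn (ae_restrict_of_ae hnn)
      (LE.le.eventuallyLE (Ici_subset_Ici.2 hab))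
  have hlt : mean μ / m < mean μ := div_lt_self hmean hm
  have hpos : 0 < mean μ / m := by positivity
  set S : Set ℝ := {x | ∫ t in Ici x, t ∂μ ≤ mean μ / m} with hS
  -- An atom at the infimum may break the bound for the closed tail, so the open tail is reached as
  -- a limit of closed tails from the right.
  have hright : ∀ b : ℝ,
      Tendsto (fun i : ℕ => f (b + 1 / ((i : ℝ) + 1))) atTop (𝓝 (∫ t in Ioi b, t ∂μ)) := by
    intro b
    have hU : ⋃ i : ℕ, Ici (b + 1 / ((i : ℝ) + 1)) = Ioi b := by
      ext x
      simp only [mem_iUnion, mem_Ici, mem_Ioi]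
      constructor
      · rintro ⟨i, hi⟩
        have : 0 < 1 / ((i : ℝ) + 1) := by positivity
        linarith
      · intro hx
        obtain ⟨i, hi⟩ := exists_nat_one_div_lt (sub_pos.2 hx)
        exact ⟨i, by linarith⟩
    rw [← hU]
    refine tendsto_setIntegral_of_monotone (fun i => measurableSet_Ici) ?_ hμ.integrableOn
    intro i j hij
    refine Ici_subset_Ici.2 ?_
    gcongr
  have hIoi0 : ∫ t in Ioi (0 : ℝ), t ∂μ = mean μ := by
    rw [mean, ← integral_add_compl (measurableSet_Ioi (a := (0 : ℝ))) hμ, compl_Ioi]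
    have : ∫ t in Iic (0 : ℝ), t ∂μ = 0 := by
      refine (setIntegral_congr_ae (g := fun _ => (0 : ℝ)) measurableSet_Iic ?_).trans (by simp)
      filter_upwards [hnn] with x hx hx0
      exact le_antisymm hx0 hx
    rw [this, add_zero]
  obtain ⟨x₀, hx₀, hfx₀⟩ : ∃ x₀, 0 < x₀ ∧ mean μ / m < f x₀ := by
    have h := hright 0
    rw [hIoi0] at h
    obtain ⟨i, hi⟩ := (h.eventually (lt_mem_nhds hlt)).exists
    exact ⟨_, by positivity, hi⟩
  have hlower : ∀ x ∈ S, x₀ ≤ x := by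
    intro x hx
    by_contra hlt'
    push Not at hlt'
    exact absurd ((hanti hlt'.le).trans hx) (not_le.2 hfx₀)
  -- Without this the infimum could be the default value 0.
  have hne : S.Nonempty := by
    have hI : ⋂ i : ℕ, Ici (i : ℝ) = ∅ := by
      ext x
      simp only [mem_iInter, mem_Ici, mem_empty_iff_false, iff_false, not_forall, not_le]
      exact exists_nat_gt x
    have h := tendsto_setIntegral_of_antitone (f := fun x : ℝ => x) (μ := μ)
      (s := fun i : ℕ => Ici (i : ℝ)) (fun i => measurableSet_Ici)
      (fun i j hij => Ici_subset_Ici.2 (by exact_mod_cast hij)) ⟨0, hμ.integrableOn⟩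
    rw [hI, Measure.restrict_empty, integral_zero_measure] at h
    obtain ⟨i, hi⟩ := (h.eventually (gt_mem_nhds hpos)).exists
    exact ⟨i, hi.le⟩
  refine ⟨hx₀.trans_le (le_csInf hne hlower), ?_⟩
  refine le_of_tendsto (hright _) (Eventually.of_forall fun i => ?_)
  obtain ⟨y, hy, hyx⟩ := exists_lt_of_csInf_lt hne
    (show sInf S < tailThreshold μ m + 1 / ((i : ℝ) + 1) from
      lt_add_of_pos_right _ (by positivity))
  exact (hanti hyx.le).trans hy

/-- This is what makes at most half of the boxes noisy, and the source of the bound 46: the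
inequality fails at 45. It is checked at 46 through 46^6 ≤ e^23 and propagated by the tangent line
of the logarithm there. -/
lemma twelve_mul_log_le {n : ℕ} (hn : 46 ≤ n) : 12 * Real.log n ≤ n := by
  have h46 : Real.log 46 ≤ 23 / 6 := by
    rw [Real.log_le_iff_le_exp (by norm_num)]
    have h1 : (46 : ℝ) ^ 6 ≤ Real.exp (23 / 6) ^ 6 := by
      rw [← Real.exp_nat_mul]
      have : ((6 : ℕ) : ℝ) * (23 / 6) = ((23 : ℕ) : ℝ) * 1 := by norm_num
      rw [this, Real.exp_nat_mul]
      calc (46 : ℝ) ^ 6 ≤ 2.7182818283 ^ 23 := by norm_num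
        _ ≤ _ := by gcongr; exact Real.exp_one_gt_d9.le
    exact le_of_pow_le_pow_left₀ (by norm_num) (Real.exp_pos _).le h1
  have hn' : (46 : ℝ) ≤ n := by exact_mod_cast hn
  have h2 := Real.log_le_sub_one_of_pos (show 0 < (n : ℝ) / 46 by positivity)
  rw [Real.log_div (by positivity) (by norm_num)] at h2
  linarith

lemma one_le_log {n : ℕ} (hn : 46 ≤ n) : 1 ≤ Real.log n := by
  rw [Real.le_log_iff_exp_le (by positivity)]
  have hn' : (46 : ℝ) ≤ n := by exact_mod_cast hn
  linarith [Real.exp_one_lt_d9]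

lemma two_thirds_pow_le {n k : ℕ} (hn : 46 ≤ n) (hk : 5 * Real.log n ≤ k) :
    (2 / 3 : ℝ) ^ k ≤ 1 / n := by
  have hn' : (0 : ℝ) < n := by positivity
  have h1 : (2 / 3 : ℝ) ≤ Real.exp (-1 / 3) := by
    linarith [Real.add_one_le_exp (-1 / 3 : ℝ)]
  calc (2 / 3 : ℝ) ^ k ≤ Real.exp (-1 / 3) ^ k := by gcongr
    _ = Real.exp (k * (-1 / 3)) := by rw [Real.exp_nat_mul]
    _ ≤ Real.exp (-Real.log n) := by
        apply Real.exp_le_exp.2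
        linarith [one_le_log hn]
    _ = 1 / n := by rw [Real.exp_neg, Real.exp_log hn', one_div]

end NoisyBoxes

/-! ### Probabilities of events about independent noises. -/

section Pi

open Set

lemma pi_real_forall_le {ι : Type*} [Fintype ι] (P : ι → Prop) [DecidablePred P]
    (ν : ι → Measure ℝ) [∀ i, IsProbabilityMeasure (ν i)] (γ : Measure ℝ)
    (hν : ∀ i, P i → ν i = γ) (a : ℝ) :
    (Measure.pi ν).real {ε | ∀ i, P i → ε i ≤ a}
      = γ.real (Iic a) ^ (Finset.univ.filter P).card := by
  have hset : {ε : ι → ℝ | ∀ i, P i → ε i ≤ a}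
      = Set.pi univ fun i => if P i then Iic a else univ := by
    ext ε
    simp only [mem_ofPred_eq, mem_pi, mem_univ, true_imp_iff]
    refine forall_congr' fun i => ?_
    by_cases h : P i <;> simp [h]
  rw [hset, measureReal_def, Measure.pi_pi, ENNReal.toReal_prod, ← Finset.prod_const,
    Finset.prod_filter]
  refine Finset.prod_congr rfl fun i _ => ?_
  by_cases h : P i
  · simp [h, hν i h, measureReal_def]
  · simp [h]

/-- Condition on the j-th noise being e: the other selected noises are independent and each must lie
below a + e. The exponent loses one because j itself is selected. -/
lemma pi_real_forall_le_add {n : ℕ} (P : Fin n → Prop) [DecidablePred P]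
    (ν : Fin n → Measure ℝ) [∀ i, IsProbabilityMeasure (ν i)] (γ : Measure ℝ)
    (hν : ∀ i, P i → ν i = γ) (j : Fin n) (hj : P j) (a : ℝ) :
    (Measure.pi ν).real {ε | ∀ i, i ≠ j → P i → ε i ≤ a + ε j}
      = ∫ e, γ.real (Iic (a + e)) ^ ((Finset.univ.filter P).card - 1) ∂γ := by
  obtain _ | N := n
  · exact j.elim0
  have hmp := measurePreserving_piFinSuccAbove ν j
  have hT : MeasurableSet {p : ℝ × (Fin N → ℝ) | ∀ l, P (j.succAbove l) → p.2 l ≤ a + p.1} := by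
    simp only [ofPred_forall]
    refine MeasurableSet.iInter fun l => MeasurableSet.iInter fun _ => ?_
    exact measurableSet_le (by fun_prop) (by fun_prop)
  have hpre : {ε : Fin (N + 1) → ℝ | ∀ i, i ≠ j → P i → ε i ≤ a + ε j}
      = (MeasurableEquiv.piFinSuccAbove (fun _ => ℝ) j) ⁻¹'
        {p : ℝ × (Fin N → ℝ) | ∀ l, P (j.succAbove l) → p.2 l ≤ a + p.1} := by
    ext ε
    simp only [mem_ofPred_eq, mem_preimage, MeasurableEquiv.piFinSuccAbove_apply]
    constructor
    · intro h l hl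
      exact h _ (Fin.succAbove_ne j l) hl
    · intro h i hi hPi
      obtain ⟨l, rfl⟩ := Fin.exists_succAbove_eq hi
      exact h l hPi
  have hcard : (Finset.univ.filter P).card - 1
      = (Finset.univ.filter fun l => P (j.succAbove l)).card := by
    rw [Finset.card_filter, Finset.card_filter, Fin.sum_univ_succAbove _ j]
    simp [hj]
  rw [hpre, measureReal_def, hmp.measure_preimage hT.nullMeasurableSet, Measure.prod_apply hT,
    hν j hj, hcard]
  have : IsProbabilityMeasure γ := hν j hj ▸ inferInstance
  rw [← integral_toReal (measurable_measure_prodMk_left hT).aemeasurable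
    (Filter.Eventually.of_forall fun _ => measure_lt_top _ _)]
  congr 1
  ext e
  rw [← pi_real_forall_le (fun l => P (j.succAbove l)) (fun l => ν (j.succAbove l)) γ
    (fun l hl => hν _ hl)]
  rfl

end Pi

/-! ### Expectation of the maximum reward. -/

namespace NoisyBoxes

open Filter Set Topology

variable {D : Measure ℝ}

lemma measurable_max (n : ℕ) : Measurable fun x : Fin n → ℝ => ⨆ i, x i :=
  Measurable.iSup fun i => measurable_pi_apply i

lemma max_nonneg {n : ℕ} {x : Fin n → ℝ} (hx : ∀ i, 0 ≤ x i) : 0 ≤ ⨆ i, x i :=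
  Real.iSup_nonneg hx

lemma le_max {n : ℕ} (x : Fin n → ℝ) (i : Fin n) : x i ≤ ⨆ i, x i :=
  le_ciSup (Set.finite_range x).bddAbove i

lemma max_le_sum {n : ℕ} {x : Fin n → ℝ} (hx : ∀ i, 0 ≤ x i) : ⨆ i, x i ≤ ∑ i, x i :=
  Real.iSup_le (fun i => Finset.single_le_sum (fun j _ => hx j) (Finset.mem_univ i))
    (Finset.sum_nonneg fun i _ => hx i)

lemma ae_nonneg_of_Iio (hD0 : D (Iio 0) = 0) : ∀ᵐ x ∂D, 0 ≤ x := by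
  rw [ae_iff]; simpa [Iio] using hD0

lemma ae_pi_nonneg [IsProbabilityMeasure D] (hD0 : D (Iio 0) = 0) (n : ℕ) :
    ∀ᵐ x ∂(Measure.pi fun _ : Fin n => D), ∀ i, 0 ≤ x i := by
  rw [ae_all_iff]
  intro i
  exact (measurePreserving_eval (fun _ : Fin n => D) i).quasiMeasurePreserving.ae
    (ae_nonneg_of_Iio hD0)

lemma integrable_eval [IsProbabilityMeasure D] (hD : Integrable (fun x : ℝ => x) D) {n : ℕ}
    (i : Fin n) : Integrable (fun x : Fin n → ℝ => x i) (Measure.pi fun _ : Fin n => D) :=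
  integrable_comp_eval (μ := fun _ : Fin n => D) (i := i) (f := fun x : ℝ => x) hD

lemma integral_eval [IsProbabilityMeasure D] {n : ℕ} (i : Fin n) :
    ∫ x : Fin n → ℝ, x i ∂(Measure.pi fun _ : Fin n => D) = mean D :=
  integral_comp_eval (μ := fun _ : Fin n => D) (f := fun x : ℝ => x) (by fun_prop)

lemma integrable_of_le_sum [IsProbabilityMeasure D] (hD0 : D (Iio 0) = 0)
    (hD : Integrable (fun x : ℝ => x) D) {n : ℕ} {f : (Fin n → ℝ) → ℝ} (hf : Measurable f)
    (hle : ∀ x, (∀ i, 0 ≤ x i) → 0 ≤ f x ∧ f x ≤ ∑ i, x i) :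
    Integrable f (Measure.pi fun _ : Fin n => D) := by
  refine Integrable.mono' (integrable_finsetSum Finset.univ fun i _ => integrable_eval hD i)
    hf.aestronglyMeasurable ?_
  filter_upwards [ae_pi_nonneg hD0 n] with x hx
  rw [Real.norm_of_nonneg (hle x hx).1]
  exact (hle x hx).2

lemma integrable_max [IsProbabilityMeasure D] (hD0 : D (Iio 0) = 0)
    (hD : Integrable (fun x : ℝ => x) D) (n : ℕ) :
    Integrable (fun x : Fin n → ℝ => ⨆ i, x i) (Measure.pi fun _ : Fin n => D) :=
  integrable_of_le_sum hD0 hD (measurable_max n) fun _ hx => ⟨max_nonneg hx, max_le_sum hx⟩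

lemma mean_maxLaw (D : Measure ℝ) (n : ℕ) :
    mean (maxLaw D n) = ∫ x, ⨆ i, x i ∂(Measure.pi fun _ : Fin n => D) :=
  integral_map (measurable_max n).aemeasurable (by fun_prop)

lemma mean_maxLaw_nonneg [IsProbabilityMeasure D] (hD0 : D (Iio 0) = 0) (n : ℕ) :
    0 ≤ mean (maxLaw D n) := by
  rw [mean_maxLaw]
  refine integral_nonneg_of_ae ?_
  filter_upwards [ae_pi_nonneg hD0 n] with x hx using max_nonneg hx

lemma mean_le_mean_maxLaw [IsProbabilityMeasure D] (hD0 : D (Iio 0) = 0)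
    (hD : Integrable (fun x : ℝ => x) D) {n : ℕ} (i : Fin n) : mean D ≤ mean (maxLaw D n) := by
  rw [mean_maxLaw, ← integral_eval i]
  exact integral_mono (integrable_eval hD i) (integrable_max hD0 hD n) fun x => le_max x i

lemma mean_maxLaw_le [IsProbabilityMeasure D] (hD0 : D (Iio 0) = 0)
    (hD : Integrable (fun x : ℝ => x) D) (n : ℕ) : mean (maxLaw D n) ≤ n * mean D := by
  calc mean (maxLaw D n) ≤ ∫ x, ∑ i, x i ∂(Measure.pi fun _ : Fin n => D) := by
        rw [mean_maxLaw]
        refine integral_mono_ae (integrable_max hD0 hD n)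
          (integrable_finsetSum Finset.univ fun i _ => integrable_eval hD i) ?_
        filter_upwards [ae_pi_nonneg hD0 n] with x hx using max_le_sum hx
    _ = n * mean D := by
        rw [integral_finsetSum _ fun i _ => integrable_eval hD i]
        simp [integral_eval]

lemma maxLaw_Iio [IsProbabilityMeasure D] (hD0 : D (Iio 0) = 0) (n : ℕ) :
    maxLaw D n (Iio 0) = 0 := by
  rw [maxLaw, Measure.map_apply (measurable_max n) measurableSet_Iio]
  refine measure_mono_null (fun x hx => ?_) (ae_iff.1 (ae_pi_nonneg hD0 n))
  exact fun h => absurd (max_nonneg h) (not_le.2 hx)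

lemma integrable_maxLaw [IsProbabilityMeasure D] (hD0 : D (Iio 0) = 0)
    (hD : Integrable (fun x : ℝ => x) D) (n : ℕ) : Integrable (fun x : ℝ => x) (maxLaw D n) :=
  (integrable_map_measure (by fun_prop) (measurable_max n).aemeasurable).2
    (integrable_max hD0 hD n)

/-- The maximum over at least half of the boxes has at least half of the expectation of the maximum
over all boxes. -/
lemma mean_maxLaw_le_two_mul [IsProbabilityMeasure D] (hD0 : D (Iio 0) = 0)
    (hD : Integrable (fun x : ℝ => x) D) {n m : ℕ} (hnm : n ≤ 2 * m) :
    mean (maxLaw D n)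
      ≤ 2 * ∫ x, ⨆ i : Fin n, (if (i : ℕ) < m then x i else 0) ∂(Measure.pi fun _ : Fin n => D) := by
  set g : (Fin n → ℝ) → ℝ := fun x => ⨆ i : Fin n, (if (i : ℕ) < m then x i else 0) with hg
  have hgm : Measurable g := Measurable.iSup fun i => by split_ifs <;> fun_prop
  have hg0 : ∀ {x : Fin n → ℝ}, (∀ i, 0 ≤ x i) → 0 ≤ g x := fun hx =>
    Real.iSup_nonneg fun i => by split_ifs <;> simp [hx]
  have hgi : Integrable g (Measure.pi fun _ : Fin n => D) := by
    refine integrable_of_le_sum hD0 hD hgm fun x hx => ⟨hg0 hx, ?_⟩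
    refine Real.iSup_le (fun i => ?_) (Finset.sum_nonneg fun i _ => hx i)
    refine le_trans ?_ (Finset.single_le_sum (fun j _ => hx j) (Finset.mem_univ i))
    split_ifs <;> simp [hx]
  -- Index reversal preserves the product law and, as n ≤ 2m, sends every index at or above m below
  -- m. Hence the full maximum is at most g(x) + g(reversed x).
  have hmp : MeasurePreserving (MeasurableEquiv.arrowCongr' (Fin.revPerm (n := n))
      (MeasurableEquiv.refl ℝ)) (Measure.pi fun _ : Fin n => D) (Measure.pi fun _ : Fin n => D) :=
    measurePreserving_arrowCongr' (fun _ : Fin n => D) (fun _ : Fin n => D) _ _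
      fun _ => MeasurePreserving.id D
  set r := MeasurableEquiv.arrowCongr' (Fin.revPerm (n := n)) (MeasurableEquiv.refl ℝ) with hr
  have hrx : ∀ x i, r x i = x i.rev := fun x i => rfl
  have hgr : Integrable (fun x => g (r x)) (Measure.pi fun _ : Fin n => D) :=
    hmp.integrable_comp_of_integrable hgi
  have hle : ∀ (x : Fin n → ℝ) (i : Fin n), (i : ℕ) < m → x i ≤ g x := fun x i hi => by
    have := le_ciSup (Set.finite_range fun i : Fin n => if (i : ℕ) < m then x i else 0).bddAbove i
    simpa [hi] using this
  calc mean (maxLaw D n) ≤ ∫ x, (g x + g (r x)) ∂(Measure.pi fun _ : Fin n => D) := by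
        rw [mean_maxLaw]
        refine integral_mono_ae (integrable_max hD0 hD n) (hgi.add hgr) ?_
        filter_upwards [ae_pi_nonneg hD0 n] with x hx
        have hx' : ∀ i, 0 ≤ r x i := fun i => hx _
        refine Real.iSup_le (fun i => ?_) (add_nonneg (hg0 hx) (hg0 hx'))
        by_cases hi : (i : ℕ) < m
        · linarith [hle x i hi, hg0 hx']
        · have h1 := hle (r x) i.rev (by rw [Fin.val_rev]; omega)
          rw [hrx, Fin.rev_rev] at h1
          linarith [hg0 hx]
    _ = 2 * ∫ x, g x ∂(Measure.pi fun _ : Fin n => D) := by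
        rw [integral_add hgi hgr, hmp.integral_comp' g]
        ring

/-! ### The joint law and a lower bound for the optimal policy. -/

instance [IsProbabilityMeasure D] {n : ℕ} (σ : Fin n → ℝ≥0) :
    IsProbabilityMeasure (jointLaw D σ) := by
  unfold jointLaw; infer_instance

lemma ae_jointLaw_fst [IsProbabilityMeasure D] {n : ℕ} (σ : Fin n → ℝ≥0)
    {p : (Fin n → ℝ) → Prop} (h : ∀ᵐ x ∂(Measure.pi fun _ : Fin n => D), p x) :
    ∀ᵐ ω ∂(jointLaw D σ), p ω.1 :=
  (measurePreserving_fst (μ := Measure.pi fun _ : Fin n => D)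
    (ν := Measure.pi fun i => gaussianReal 0 (σ i ^ 2))).quasiMeasurePreserving.ae h

lemma ae_noise_eq_zero [IsProbabilityMeasure D] {n : ℕ} (σ : Fin n → ℝ≥0) :
    ∀ᵐ ω ∂(jointLaw D σ), ∀ i, σ i = 0 → ω.2 i = 0 := by
  have h : ∀ᵐ ε ∂(Measure.pi fun i => gaussianReal 0 (σ i ^ 2)), ∀ i, σ i = 0 → ε i = 0 := by
    rw [ae_all_iff]
    intro i
    refine (measurePreserving_eval (fun i => gaussianReal 0 (σ i ^ 2)) i).quasiMeasurePreserving.ae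
      (p := fun e => σ i = 0 → e = 0) ?_
    by_cases hi : σ i = 0
    · simp [hi, gaussianReal_zero_var]
    · simp [hi]
  exact (measurePreserving_snd (μ := Measure.pi fun _ : Fin n => D)).quasiMeasurePreserving.ae h

lemma integrable_reward [IsProbabilityMeasure D] (hD : Integrable (fun x : ℝ => x) D) {n : ℕ}
    (σ : Fin n → ℝ≥0) (i : Fin n) : Integrable (reward i) (jointLaw D σ) :=
  (integrable_eval hD i).comp_fst _

lemma integral_fst [IsProbabilityMeasure D] {n : ℕ} (σ : Fin n → ℝ≥0) (f : (Fin n → ℝ) → ℝ) :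
    ∫ ω, f ω.1 ∂(jointLaw D σ) = ∫ x, f x ∂(Measure.pi fun _ : Fin n => D) := by
  have := integral_prod_mul (μ := Measure.pi fun _ : Fin n => D)
    (ν := Measure.pi fun i => gaussianReal 0 (σ i ^ 2)) f (fun _ => (1 : ℝ))
  simpa [jointLaw] using this

/-- The optimal policy does at least as well as choosing the best box among the noiseless ones. -/
lemma integral_noiseless_max_le_optReward [IsProbabilityMeasure D] (hD0 : D (Iio 0) = 0)
    (hD : Integrable (fun x : ℝ => x) D) {n : ℕ} (σ : Fin n → ℝ≥0) :
    ∫ x, ⨆ i : Fin n, (if σ i = 0 then x i else 0) ∂(Measure.pi fun _ : Fin n => D)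
      ≤ optReward D σ := by
  have hobs : ∀ i : Fin n, Measurable (obs i) := fun i => by unfold obs; fun_prop
  -- For an exact box the observation is almost surely the reward, so conditioning on it changes
  -- nothing. For noisy boxes only nonnegativity of the posterior mean is used.
  have hcond : ∀ i : Fin n, σ i = 0 →
      (jointLaw D σ)[reward i | MeasurableSpace.comap (obs i) inferInstance]
        =ᵐ[jointLaw D σ] reward i := by
    intro i hi
    have h1 : reward i =ᵐ[jointLaw D σ] obs i := by
      filter_upwards [ae_noise_eq_zero σ] with ω hω
      simp [reward, obs, hω i hi]
    have h2 := condExp_of_stronglyMeasurable (μ := jointLaw D σ) (hobs i).comap_le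
      (comap_measurable (obs i)).stronglyMeasurable ((integrable_reward hD σ i).congr h1)
    exact (condExp_congr_ae h1).trans (by rw [h2]; exact h1.symm)
  have hnn : ∀ i : Fin n, 0 ≤ᵐ[jointLaw D σ]
      (jointLaw D σ)[reward i | MeasurableSpace.comap (obs i) inferInstance] := fun i => by
    refine condExp_nonneg ?_
    filter_upwards [ae_jointLaw_fst σ (ae_pi_nonneg hD0 n)] with ω hω using hω i
  have hae : ∀ᵐ ω ∂(jointLaw D σ), ∀ i : Fin n,
      0 ≤ ((jointLaw D σ)[reward i | MeasurableSpace.comap (obs i) inferInstance]) ω ∧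
      (σ i = 0 → ((jointLaw D σ)[reward i | MeasurableSpace.comap (obs i) inferInstance]) ω
        = ω.1 i) := by
    rw [ae_all_iff]
    intro i
    by_cases hi : σ i = 0
    · filter_upwards [hnn i, hcond i hi] with ω h1 h2 using ⟨h1, fun _ => h2⟩
    · filter_upwards [hnn i] with ω h1 using ⟨h1, fun h => absurd h hi⟩
  rw [← integral_fst σ, optReward]
  refine integral_mono_of_nonneg ?_ ?_ ?_
  · filter_upwards [ae_jointLaw_fst σ (ae_pi_nonneg hD0 n)] with ω hω
    exact Real.iSup_nonneg fun i => by split_ifs <;> simp [hω]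
  · refine Integrable.mono' (integrable_finsetSum Finset.univ fun i _ => integrable_condExp
      (μ := jointLaw D σ) (m := MeasurableSpace.comap (obs i) inferInstance) (f := reward i)) ?_ ?_
    · exact (Measurable.iSup fun i => (stronglyMeasurable_condExp.measurable.mono
        (hobs i).comap_le le_rfl)).aestronglyMeasurable
    · filter_upwards [hae] with ω hω
      rw [Real.norm_of_nonneg (max_nonneg fun i => (hω i).1)]
      exact max_le_sum fun i => (hω i).1
  · filter_upwards [hae] with ω hω
    refine Real.iSup_le (fun i => ?_) (max_nonneg fun i => (hω i).1)
    split_ifs with hi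
    · rw [← (hω i).2 hi]
      exact le_max (fun i => ((jointLaw D σ)[reward i |
        MeasurableSpace.comap (obs i) inferInstance]) ω) i
    · exact max_nonneg fun i => (hω i).1

end NoisyBoxes

/-! ### Upper bound for the naive policy. -/

namespace NoisyBoxes

open Filter Set Topology

variable {D : Measure ℝ}

lemma sum_choice_toReal {n : ℕ} (p : PMF (Fin n)) : ∑ i, (p i).toReal = 1 := by
  rw [← ENNReal.toReal_sum fun i _ => p.apply_ne_top i, ← tsum_fintype (L := .unconditional _),
    p.tsum_coe, ENNReal.toReal_one]

lemma choice_toReal_le_one {n : ℕ} (p : PMF (Fin n)) (i : Fin n) : (p i).toReal ≤ 1 :=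
  ENNReal.toReal_mono ENNReal.one_ne_top (p.coe_le_one i)

/-- All noises are at most `β`. -/
def lowNoise {n : ℕ} (σ : Fin n → ℝ≥0) (β : ℝ) : Set (Fin n → ℝ) :=
  {ε | ∀ l, σ l ≠ 0 → ε l ≤ β}

/-- The reward of box `i` is at most `β` and its observation exceeds all other noises. -/
def leading {n : ℕ} (σ : Fin n → ℝ≥0) (β : ℝ) (i : Fin n) :
    Set ((Fin n → ℝ) × (Fin n → ℝ)) :=
  {ω | ω.1 i ≤ β ∧ ∀ l, l ≠ i → σ l ≠ 0 → ω.2 l ≤ ω.1 i + ω.2 i}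

lemma measurableSet_lowNoise {n : ℕ} (σ : Fin n → ℝ≥0) (β : ℝ) :
    MeasurableSet (lowNoise σ β) := by
  simp only [lowNoise, ofPred_forall]
  exact MeasurableSet.iInter fun l => MeasurableSet.iInter fun _ =>
    measurableSet_le (by fun_prop) (by fun_prop)

lemma measurableSet_leading {n : ℕ} (σ : Fin n → ℝ≥0) (β : ℝ) (i : Fin n) :
    MeasurableSet (leading σ β i) := by
  refine (measurableSet_le (f := fun ω : (Fin n → ℝ) × (Fin n → ℝ) => ω.1 i) (g := fun _ => β)
    (by fun_prop) (by fun_prop)).inter ?_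
  change MeasurableSet {ω : (Fin n → ℝ) × (Fin n → ℝ) |
    ∀ l, l ≠ i → σ l ≠ 0 → ω.2 l ≤ ω.1 i + ω.2 i}
  simp only [ofPred_forall]
  exact MeasurableSet.iInter fun l => MeasurableSet.iInter fun _ => MeasurableSet.iInter fun _ =>
    measurableSet_le (by fun_prop) (by fun_prop)

/-- If the largest reward exceeds β, the choice pays at most that reward. Otherwise, when box i can
be chosen, each noise ε_l ≤ x_l + ε_l ≤ x_i + ε_i: for an exact box the right side is at most β, for
a noisy one this is the `leading` event. Only necessary conditions for winning enter, so
tie-breaking is irrelevant. -/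
lemma Policy.IsNaive.sum_le {n : ℕ} {A : Policy n} (hA : A.IsNaive) (σ : Fin n → ℝ≥0) (β : ℝ)
    {ω : (Fin n → ℝ) × (Fin n → ℝ)} (hω : ∀ i, 0 ≤ ω.1 i) (hε : ∀ i, σ i = 0 → ω.2 i = 0) :
    ∑ i, (A.choice σ (fun j => obs j ω) i).toReal * reward i ω
      ≤ (Ioi β).indicator (fun t => t) (⨆ i, ω.1 i)
        + ∑ i, if σ i = 0 then ω.1 i * (lowNoise σ β).indicator 1 ω.2
          else ω.1 i * (leading σ β i).indicator 1 ω := by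
  set p := A.choice σ (fun j => obs j ω) with hp
  have hterm : ∀ i, 0 ≤ if σ i = 0 then ω.1 i * (lowNoise σ β).indicator 1 ω.2
      else ω.1 i * (leading σ β i).indicator 1 ω := fun i => by
    split_ifs
    · exact mul_nonneg (hω i) (indicator_nonneg (fun _ _ => zero_le_one) _)
    · exact mul_nonneg (hω i) (indicator_nonneg (fun _ _ => zero_le_one) _)
  by_cases hβ : β < ⨆ i, ω.1 i
  · rw [indicator_of_mem (mem_Ioi.2 hβ)]
    refine le_add_of_le_of_nonneg ?_ (Finset.sum_nonneg fun i _ => hterm i)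
    calc _ ≤ ∑ i, (p i).toReal * ⨆ i, ω.1 i := Finset.sum_le_sum fun i _ =>
            mul_le_mul_of_nonneg_left (le_max ω.1 i) ENNReal.toReal_nonneg
      _ = ⨆ i, ω.1 i := by rw [← Finset.sum_mul, sum_choice_toReal, one_mul]
  · rw [indicator_of_notMem (by simpa using hβ), zero_add]
    push Not at hβ
    refine Finset.sum_le_sum fun i _ => ?_
    have hi : ω.1 i ≤ β := (le_max ω.1 i).trans hβ
    by_cases hpi : p i = 0
    · simpa [hpi] using hterm i
    have hmax : ∀ j, ω.1 j + ω.2 j ≤ ω.1 i + ω.2 i := hA σ _ i ((PMF.mem_support_iff _ _).2 hpi)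
    have hle : (p i).toReal * reward i ω ≤ ω.1 i * 1 := by
      rw [mul_one]
      exact mul_le_of_le_one_left (hω i) (choice_toReal_le_one p i)
    split_ifs with h0
    · have : ω.2 ∈ lowNoise σ β := fun l _ => by
        linarith [hmax l, hω l, hε i h0]
      simpa [indicator_of_mem this] using hle
    · have : ω ∈ leading σ β i := ⟨hi, fun l _ _ => by linarith [hmax l, hω l]⟩
      simpa [indicator_of_mem this] using hle

lemma integrable_mul_lowNoise [IsProbabilityMeasure D]
    (hD : Integrable (fun x : ℝ => x) D) {n : ℕ} (σ : Fin n → ℝ≥0) (β : ℝ) (i : Fin n) :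
    Integrable (fun ω => ω.1 i * (lowNoise σ β).indicator 1 ω.2) (jointLaw D σ) := by
  refine (integrable_reward hD σ i).mul_bdd (c := 1) ?_ (Eventually.of_forall fun ω => ?_)
  · exact ((measurable_const.indicator (measurableSet_lowNoise σ β)).comp
      measurable_snd).aestronglyMeasurable
  · exact (norm_indicator_le_norm_self _ _).trans (by simp)

lemma integral_mul_lowNoise [IsProbabilityMeasure D] {n : ℕ} (σ : Fin n → ℝ≥0) (β : ℝ)
    (i : Fin n) {v : ℝ≥0} (hσ : ∀ l, σ l ≠ 0 → σ l ^ 2 = v) :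
    ∫ ω, ω.1 i * (lowNoise σ β).indicator 1 ω.2 ∂(jointLaw D σ)
      = mean D * (gaussianReal 0 v).real (Iic β) ^ (Finset.univ.filter fun l => σ l ≠ 0).card := by
  rw [jointLaw, integral_prod_mul (fun x : Fin n → ℝ => x i), integral_eval,
    integral_indicator_one (measurableSet_lowNoise σ β)]
  congr 1
  exact pi_real_forall_le (fun l => σ l ≠ 0) _ _ (fun l hl => by rw [hσ l hl]) β

lemma integrable_mul_leading [IsProbabilityMeasure D]
    (hD : Integrable (fun x : ℝ => x) D) {n : ℕ} (σ : Fin n → ℝ≥0) (β : ℝ) (i : Fin n) :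
    Integrable (fun ω => ω.1 i * (leading σ β i).indicator 1 ω) (jointLaw D σ) := by
  refine (integrable_reward hD σ i).mul_bdd (c := 1) ?_ (Eventually.of_forall fun ω => ?_)
  · exact (measurable_const.indicator (measurableSet_leading σ β i)).aestronglyMeasurable
  · exact (norm_indicator_le_norm_self _ _).trans (by simp)

/-- Fix the rewards and integrate over the noises: the event involves only x_i, and its conditional
probability is bounded uniformly for x_i in [0, β]. For x_i > β the event is empty, which is why the
cutoff is part of it. -/
lemma integral_mul_leading_le [IsProbabilityMeasure D] (hD0 : D (Iio 0) = 0)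
    (hD : Integrable (fun x : ℝ => x) D) {n : ℕ} (σ : Fin n → ℝ≥0) {β L : ℝ} (hβ : 0 < β)
    (hL : 1 ≤ L) {v : ℝ≥0} (hv : (v : ℝ) = 36 * β ^ 2 * L) (hσ : ∀ l, σ l ≠ 0 → σ l ^ 2 = v)
    {i : Fin n} (hi : σ i ≠ 0) :
    ∫ ω, ω.1 i * (leading σ β i).indicator 1 ω ∂(jointLaw D σ)
      ≤ mean D * (Real.exp (1 / 4)
        * (1 / ((Finset.univ.filter fun l => σ l ≠ 0).card : ℝ) + Real.exp (-L))) := by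
  set k := (Finset.univ.filter fun l => σ l ≠ 0).card with hk
  have hkpos : 0 < k := Finset.card_pos.2 ⟨i, by simp [hi]⟩
  set ν := Measure.pi fun i => gaussianReal 0 (σ i ^ 2) with hν
  have hint := integrable_mul_leading hD σ β i
  rw [jointLaw] at hint ⊢
  rw [integral_prod _ hint, ← integral_eval (D := D) i, ← integral_mul_const]
  refine integral_mono_ae hint.integral_prod_left ((integrable_eval hD i).mul_const _) ?_
  filter_upwards [ae_pi_nonneg hD0 n] with x hx
  rw [integral_const_mul]
  refine mul_le_mul_of_nonneg_left ?_ (hx i)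
  have hsec : ∀ ε, (leading σ β i).indicator (1 : (Fin n → ℝ) × (Fin n → ℝ) → ℝ) (x, ε)
      = (Prod.mk x ⁻¹' leading σ β i).indicator 1 ε := fun ε => rfl
  simp_rw [hsec]
  rw [integral_indicator_one (measurable_prodMk_left (measurableSet_leading σ β i))]
  by_cases hxβ : x i ≤ β
  · have hset : Prod.mk x ⁻¹' leading σ β i
        = {ε | ∀ l, l ≠ i → σ l ≠ 0 → ε l ≤ x i + ε i} := by
      ext ε; simp [leading, hxβ]
    rw [hset, pi_real_forall_le_add (fun l => σ l ≠ 0) _ (gaussianReal 0 v)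
      (fun l hl => by rw [hσ l hl]) i hi]
    have h := integral_gaussian_cdf_pow_shift_le hβ hL (hx i) hxβ hv (k - 1)
    have hk1 : ((k - 1 : ℕ) : ℝ) + 1 = k := by
      rw [Nat.cast_sub hkpos]; push_cast; ring
    rwa [hk1] at h
  · have hset : Prod.mk x ⁻¹' leading σ β i = ∅ := by
      ext ε; simp [leading, hxβ]
    rw [hset, measureReal_empty]
    positivity

lemma Policy.IsNaive.expectedReward_le [IsProbabilityMeasure D] (hD0 : D (Iio 0) = 0)
    (hD : Integrable (fun x : ℝ => x) D) {n : ℕ} {A : Policy n} (hA : A.IsNaive)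
    (σ : Fin n → ℝ≥0) {β L : ℝ} (hβ : 0 < β) (hL : 1 ≤ L) {v : ℝ≥0}
    (hv : (v : ℝ) = 36 * β ^ 2 * L) (hσ : ∀ l, σ l ≠ 0 → σ l ^ 2 = v)
    (hk : 0 < (Finset.univ.filter fun l => σ l ≠ 0).card) :
    A.expectedReward D σ ≤ ∫ t in Ioi β, t ∂(maxLaw D n)
      + mean D * (n * (gaussianReal 0 v).real (Iic β) ^ (Finset.univ.filter fun l => σ l ≠ 0).card
        + Real.exp (1 / 4)
          * (1 + (Finset.univ.filter fun l => σ l ≠ 0).card * Real.exp (-L))) := by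
  set k := (Finset.univ.filter fun l => σ l ≠ 0).card with hkdef
  set q := (gaussianReal 0 v).real (Iic β) ^ k with hq
  set H := Real.exp (1 / 4) * (1 / (k : ℝ) + Real.exp (-L)) with hH
  have hmean : 0 ≤ mean D := integral_nonneg_of_ae (ae_nonneg_of_Iio hD0)
  have hq0 : 0 ≤ q := pow_nonneg measureReal_nonneg _
  have hH0 : 0 ≤ H := by positivity
  have hi1 : Integrable (fun ω : (Fin n → ℝ) × (Fin n → ℝ) =>
      (Ioi β).indicator (fun t => t) (⨆ i, ω.1 i)) (jointLaw D σ) := by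
    have : Integrable (fun x : Fin n → ℝ => (Ioi β).indicator (fun t => t) (⨆ i, x i))
        (Measure.pi fun _ : Fin n => D) :=
      (integrable_max hD0 hD n).indicator (measurable_max n measurableSet_Ioi)
    exact this.comp_fst _
  have hi2 : ∀ i : Fin n, Integrable (fun ω : (Fin n → ℝ) × (Fin n → ℝ) =>
      if σ i = 0 then ω.1 i * (lowNoise σ β).indicator 1 ω.2
          else ω.1 i * (leading σ β i).indicator 1 ω) (jointLaw D σ) := fun i => by
    by_cases h : σ i = 0
    · simpa [h] using integrable_mul_lowNoise hD σ β i
    · simpa [h] using integrable_mul_leading hD σ β i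
  have hint1 : ∫ ω : (Fin n → ℝ) × (Fin n → ℝ), (Ioi β).indicator (fun t => t) (⨆ i, ω.1 i)
      ∂(jointLaw D σ) = ∫ t in Ioi β, t ∂(maxLaw D n) := by
    rw [integral_fst σ fun x => (Ioi β).indicator (fun t => t) (⨆ i, x i),
      ← integral_indicator measurableSet_Ioi, maxLaw,
      integral_map (measurable_max n).aemeasurable
        (f := (Ioi β).indicator fun t => t)
        (measurable_id.indicator measurableSet_Ioi).aestronglyMeasurable]
  -- Noisy boxes are charged q as well, so that the sum over all boxes is simply n q + k H.
  have hint2 : ∀ i : Fin n, ∫ ω : (Fin n → ℝ) × (Fin n → ℝ),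
      (if σ i = 0 then ω.1 i * (lowNoise σ β).indicator 1 ω.2
          else ω.1 i * (leading σ β i).indicator 1 ω) ∂(jointLaw D σ)
      ≤ mean D * (q + if σ i ≠ 0 then H else 0) := fun i => by
    by_cases h : σ i = 0
    · simp only [h, if_true, ne_eq, not_true_eq_false, if_false, add_zero]
      exact (integral_mul_lowNoise σ β i hσ).le
    · simp only [h, if_false, ne_eq, not_false_eq_true, if_true]
      refine (integral_mul_leading_le hD0 hD σ hβ hL hv hσ h).trans ?_
      exact mul_le_mul_of_nonneg_left (le_add_of_nonneg_left hq0) hmean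
  calc A.expectedReward D σ
      ≤ ∫ ω, ((Ioi β).indicator (fun t => t) (⨆ i, ω.1 i)
        + ∑ i, if σ i = 0 then ω.1 i * (lowNoise σ β).indicator 1 ω.2
          else ω.1 i * (leading σ β i).indicator 1 ω) ∂(jointLaw D σ) := by
        refine integral_mono_of_nonneg ?_ (hi1.add (integrable_finsetSum _ fun i _ => hi2 i)) ?_
        · filter_upwards [ae_jointLaw_fst σ (ae_pi_nonneg hD0 n)] with ω hω
          exact Finset.sum_nonneg fun i _ => mul_nonneg ENNReal.toReal_nonneg (hω i)
        · filter_upwards [ae_jointLaw_fst σ (ae_pi_nonneg hD0 n), ae_noise_eq_zero σ] with ω h1 h2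
          exact hA.sum_le σ β h1 h2
    _ ≤ ∫ t in Ioi β, t ∂(maxLaw D n) + ∑ i : Fin n, mean D * (q + if σ i ≠ 0 then H else 0) := by
        rw [integral_add hi1 (integrable_finsetSum _ fun i _ => hi2 i), hint1,
          integral_finsetSum _ fun i _ => hi2 i]
        gcongr with i
        exact hint2 i
    _ = _ := by
        rw [← Finset.mul_sum, Finset.sum_add_distrib, ← Finset.sum_filter]
        simp only [Finset.sum_const, Finset.card_univ, Fintype.card_fin, nsmul_eq_mul, ← hkdef]
        have hk' : (k : ℝ) ≠ 0 := by positivity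
        rw [hH]
        field_simp

/-- With positive probability all rewards are positive, and then any selection whatsoever pays. -/
lemma Policy.expectedReward_pos [IsProbabilityMeasure D] (hD0 : D (Iio 0) = 0)
    (hD : Integrable (fun x : ℝ => x) D) (hmean : 0 < mean D) {n : ℕ} (A : Policy n)
    (σ : Fin n → ℝ≥0) : 0 < A.expectedReward D σ := by
  have hDpos : D (Ioi 0) ≠ 0 := by
    intro h
    have : ∀ᵐ x ∂D, x ≤ 0 := by rw [ae_iff]; simpa [Ioi] using h
    exact absurd (integral_nonpos_of_ae this) (not_le.2 hmean)
  have hobs : Measurable fun (ω : (Fin n → ℝ) × (Fin n → ℝ)) (j : Fin n) => obs j ω := by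
    unfold obs; fun_prop
  have hmeas : Measurable fun ω : (Fin n → ℝ) × (Fin n → ℝ) =>
      ∑ i, (A.choice σ (fun j => obs j ω) i).toReal * reward i ω := by
    refine Finset.measurable_fun_sum _ fun i _ => Measurable.mul ?_ ?_
    · exact ((A.measurable_choice σ i).comp hobs).ennreal_toReal
    · unfold reward; fun_prop
  have hnn := ae_jointLaw_fst σ (ae_pi_nonneg hD0 n)
  have hnonneg : 0 ≤ᵐ[jointLaw D σ] fun ω =>
      ∑ i, (A.choice σ (fun j => obs j ω) i).toReal * reward i ω := by
    filter_upwards [hnn] with ω hω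
    exact Finset.sum_nonneg fun i _ => mul_nonneg ENNReal.toReal_nonneg (hω i)
  have hint : Integrable (fun ω =>
      ∑ i, (A.choice σ (fun j => obs j ω) i).toReal * reward i ω) (jointLaw D σ) := by
    refine Integrable.mono' (integrable_finsetSum Finset.univ fun i _ => integrable_reward hD σ i)
      hmeas.aestronglyMeasurable ?_
    filter_upwards [hnn, hnonneg] with ω hω h0
    rw [Real.norm_of_nonneg h0]
    exact Finset.sum_le_sum fun i _ => mul_le_of_le_one_left (hω i) (choice_toReal_le_one _ i)
  rw [Policy.expectedReward, integral_pos_iff_support_of_nonneg_ae hnonneg hint]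
  have hrect : jointLaw D σ ((Set.pi univ fun _ : Fin n => Ioi (0 : ℝ)) ×ˢ univ) ≠ 0 := by
    rw [jointLaw, Measure.prod_prod, Measure.pi_pi]
    simp [hDpos]
  refine (pos_iff_ne_zero.2 hrect).trans_le (measure_mono fun ω hω => ?_)
  have hpos : ∀ i, 0 < ω.1 i := fun i => hω.1 i (mem_univ i)
  obtain ⟨i, hi⟩ := (A.choice σ fun j => obs j ω).support_nonempty
  refine (Finset.sum_pos' (fun j _ => mul_nonneg ENNReal.toReal_nonneg (hpos j).le)
    ⟨i, Finset.mem_univ i, mul_pos (ENNReal.toReal_pos ?_ (PMF.apply_ne_top _ i)) (hpos i)⟩).ne'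
  exact (PMF.mem_support_iff _ _).1 hi

/-! ### The bad noise vector and the comparison on it. -/

/-- The noise vector that makes the naive policy bad: the last `⌊6 ln n⌋` boxes are very noisy, all
others are noiseless. -/
noncomputable def badNoise (D : Measure ℝ) (n : ℕ) (i : Fin n) : ℝ≥0 :=
  if (i : ℕ) < n - ⌊6 * Real.log n⌋₊ then 0 else (largeNoise D n).toNNReal

/-- Rounding down loses at most 1 ≤ ln n, hence 5 ln n remains. -/
lemma floor_six_mul_log {n : ℕ} (hn : 46 ≤ n) :
    5 * Real.log n ≤ ⌊6 * Real.log n⌋₊ ∧ (⌊6 * Real.log n⌋₊ : ℝ) ≤ 6 * Real.log n ∧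
      2 * ⌊6 * Real.log n⌋₊ ≤ n := by
  have h1 := one_le_log hn
  have h2 := Nat.floor_le (show 0 ≤ 6 * Real.log n by linarith)
  have h3 := Nat.lt_floor_add_one (6 * Real.log n)
  refine ⟨by linarith, h2, ?_⟩
  have h4 := twelve_mul_log_le hn
  have : (2 : ℝ) * ⌊6 * Real.log n⌋₊ ≤ n := by linarith
  exact_mod_cast this

lemma badNoise_ne_zero_iff {n : ℕ} (hpos : 0 < largeNoise D n) (i : Fin n) :
    badNoise D n i ≠ 0 ↔ ¬ (i : ℕ) < n - ⌊6 * Real.log n⌋₊ := by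
  unfold badNoise
  split_ifs with h <;> simp [h, hpos]

lemma card_val_lt {n m : ℕ} (hm : m ≤ n) :
    (Finset.univ.filter fun i : Fin n => (i : ℕ) < m).card = m := by
  rw [Fin.card_filter_val_lt, min_eq_right hm]

lemma card_badNoise_ne_zero {n : ℕ} (hn : 46 ≤ n) (hpos : 0 < largeNoise D n) :
    (Finset.univ.filter fun i : Fin n => badNoise D n i ≠ 0).card = ⌊6 * Real.log n⌋₊ := by
  have h := (floor_six_mul_log hn).2.2
  simp_rw [badNoise_ne_zero_iff hpos]
  have h1 := Finset.card_filter_add_card_filter_not (s := (Finset.univ : Finset (Fin n)))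
    (fun i : Fin n => (i : ℕ) < n - ⌊6 * Real.log n⌋₊)
  rw [card_val_lt (Nat.sub_le _ _), Finset.card_univ, Fintype.card_fin] at h1
  omega

lemma badNoise_mem_smallNoise [IsProbabilityMeasure D] (hD0 : D (Iio 0) = 0) {n : ℕ}
    (hn : 46 ≤ n) {c : ℝ} (hc : c ≤ (n - 6 * Real.log n) / n) :
    badNoise D n ∈ smallNoise D n c := by
  have hf := floor_six_mul_log hn
  constructor
  · intro i j hij
    have hij' : (i : ℕ) ≤ j := hij
    unfold badNoise
    split_ifs
    · exact le_rfl
    · exact zero_le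
    · omega
    · exact le_rfl
  · rw [le_div_iff₀ (by positivity)] at hc
    have hcard : n - ⌊6 * Real.log n⌋₊ ≤ (Finset.univ.filter fun i : Fin n =>
        (badNoise D n i : ℝ) ≤ mean (maxLaw D ⌈c * n⌉₊) / (5 * √(2 * Real.log n))).card := by
      conv_lhs => rw [← card_val_lt (Nat.sub_le n ⌊6 * Real.log n⌋₊)]
      refine Finset.card_le_card (Finset.monotone_filter_right _ fun i _ hi => ?_)
      have : badNoise D n i = 0 := if_pos hi
      rw [this]
      exact div_nonneg (mean_maxLaw_nonneg hD0 _) (by positivity)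
    have hcard' : ((n - ⌊6 * Real.log n⌋₊ : ℕ) : ℝ) ≤ _ := Nat.cast_le.2 hcard
    rw [Nat.cast_sub (by omega)] at hcard'
    linarith [hf.2.1]

lemma mean_maxLaw_pos [IsProbabilityMeasure D] (hD0 : D (Iio 0) = 0)
    (hD : Integrable (fun x : ℝ => x) D) (hmean : 0 < mean D) {n : ℕ} (hn : 46 ≤ n) :
    0 < mean (maxLaw D n) :=
  hmean.trans_le (mean_le_mean_maxLaw hD0 hD ⟨0, by omega⟩)

lemma tailThreshold_maxLaw_spec [IsProbabilityMeasure D] (hD0 : D (Iio 0) = 0)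
    (hD : Integrable (fun x : ℝ => x) D) (hmean : 0 < mean D) {n : ℕ} (hn : 46 ≤ n) :
    0 < tailThreshold (maxLaw D n) ((n : ℝ) ^ 2) ∧
      ∫ t in Ioi (tailThreshold (maxLaw D n) ((n : ℝ) ^ 2)), t ∂(maxLaw D n)
        ≤ mean (maxLaw D n) / (n : ℝ) ^ 2 := by
  have hn' : (46 : ℝ) ≤ n := by exact_mod_cast hn
  exact tailThreshold_spec (maxLaw_Iio hD0 n) (integrable_maxLaw hD0 hD n)
    (mean_maxLaw_pos hD0 hD hmean hn) (by nlinarith)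

lemma largeNoise_pos [IsProbabilityMeasure D] (hD0 : D (Iio 0) = 0)
    (hD : Integrable (fun x : ℝ => x) D) (hmean : 0 < mean D) {n : ℕ} (hn : 46 ≤ n) :
    0 < largeNoise D n := by
  have := (tailThreshold_maxLaw_spec hD0 hD hmean hn).1
  have := one_le_log hn
  unfold largeNoise
  positivity

/-- In units of the mean, the budget is 1 for large rewards, 1 for exact boxes and 13/10 · 3/2 < 2
for noisy boxes. -/
lemma Policy.IsNaive.expectedReward_badNoise_le [IsProbabilityMeasure D] (hD0 : D (Iio 0) = 0)
    (hD : Integrable (fun x : ℝ => x) D) (hmean : 0 < mean D) {n : ℕ} (hn : 46 ≤ n)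
    {A : Policy n} (hA : A.IsNaive) : A.expectedReward D (badNoise D n) ≤ 4 * mean D := by
  have hn' : (46 : ℝ) ≤ n := by exact_mod_cast hn
  have hnpos : (0 : ℝ) < n := by linarith
  have hpos := largeNoise_pos hD0 hD hmean hn
  obtain ⟨hβ, htail⟩ := tailThreshold_maxLaw_spec hD0 hD hmean hn
  set β := tailThreshold (maxLaw D n) ((n : ℝ) ^ 2) with hβdef
  have hL := one_le_log hn
  have hcard := card_badNoise_ne_zero (D := D) hn hpos
  obtain ⟨hk5, -, hk2⟩ := floor_six_mul_log hn
  set k := ⌊6 * Real.log n⌋₊ with hk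
  have hk2' : (2 : ℝ) * k ≤ n := by exact_mod_cast hk2
  have hkpos : 0 < k := by
    have : (0 : ℝ) < k := by linarith
    exact_mod_cast this
  have hsq : ((largeNoise D n).toNNReal ^ 2 : ℝ≥0) = 36 * β ^ 2 * Real.log n := by
    push_cast
    rw [Real.coe_toNNReal _ hpos.le, largeNoise, mul_pow, mul_pow, Real.sq_sqrt (by linarith)]
    ring
  have hσ : ∀ l, badNoise D n l ≠ 0 → badNoise D n l ^ 2 = (largeNoise D n).toNNReal ^ 2 := by
    intro l hl
    rw [badNoise, if_neg ((badNoise_ne_zero_iff hpos l).1 hl)]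
  -- Taking L = ln n turns exp(-L) into 1/n.
  have h := hA.expectedReward_le hD0 hD (badNoise D n) hβ hL hsq hσ (by rw [hcard]; exact hkpos)
  rw [hcard, Real.exp_neg, Real.exp_log hnpos] at h
  have hsqrt : 1 ≤ √(Real.log n) := Real.one_le_sqrt.2 hL
  have hΦ : (gaussianReal 0 ((largeNoise D n).toNNReal ^ 2)).real (Iic β) ≤ 2 / 3 := by
    refine gaussianReal_Iic_le (s := largeNoise D n) hβ.le ?_ hpos ?_
    · rw [largeNoise]
      exact le_mul_of_one_le_right (by positivity) hsqrt
    · push_cast; rw [Real.coe_toNNReal _ hpos.le]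
  have hq : (gaussianReal 0 ((largeNoise D n).toNNReal ^ 2)).real (Iic β) ^ k ≤ 1 / n :=
    (pow_le_pow_left₀ measureReal_nonneg hΦ k).trans (two_thirds_pow_le hn hk5)
  have hq' : n * (gaussianReal 0 ((largeNoise D n).toNNReal ^ 2)).real (Iic β) ^ k ≤ 1 := by
    rwa [le_div_iff₀ hnpos, mul_comm] at hq
  have he : Real.exp (1 / 4) ≤ 13 / 10 := by
    have : Real.exp (1 / 4) ^ 4 ≤ (13 / 10) ^ 4 := by
      rw [← Real.exp_nat_mul]
      norm_num
      linarith [Real.exp_one_lt_d9]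
    exact le_of_pow_le_pow_left₀ (by norm_num) (by norm_num) this
  have hkn : (k : ℝ) * (n : ℝ)⁻¹ ≤ 1 / 2 := by
    rw [← div_eq_mul_inv, div_le_div_iff₀ hnpos (by norm_num)]; linarith
  have h3 : Real.exp (1 / 4) * (1 + k * (n : ℝ)⁻¹) ≤ 13 / 10 * (3 / 2) :=
    mul_le_mul he (by linarith) (by positivity) (by norm_num)
  have h1 : mean (maxLaw D n) / (n : ℝ) ^ 2 ≤ mean D := by
    rw [div_le_iff₀ (by positivity)]
    refine (mean_maxLaw_le hD0 hD n).trans ?_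
    rw [mul_comm]
    exact mul_le_mul_of_nonneg_left (by nlinarith) hmean.le
  have h2 := mul_le_mul_of_nonneg_left (add_le_add hq' h3) hmean.le
  linarith

lemma mean_maxLaw_le_two_mul_optReward [IsProbabilityMeasure D] (hD0 : D (Iio 0) = 0)
    (hD : Integrable (fun x : ℝ => x) D) (hmean : 0 < mean D) {n : ℕ} (hn : 46 ≤ n) :
    mean (maxLaw D n) ≤ 2 * optReward D (badNoise D n) := by
  have h1 := mean_maxLaw_le_two_mul hD0 hD (n := n) (m := n - ⌊6 * Real.log n⌋₊)
    (by have := (floor_six_mul_log hn).2.2; omega)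
  have h2 := integral_noiseless_max_le_optReward hD0 hD (badNoise D n)
  have h3 : ∀ i : Fin n, badNoise D n i = 0 ↔ (i : ℕ) < n - ⌊6 * Real.log n⌋₊ := fun i =>
    not_iff_not.1 (badNoise_ne_zero_iff (largeNoise_pos hD0 hD hmean hn) i)
  simp_rw [h3] at h2
  linarith

lemma Policy.IsNaive.expectedReward_badNoise_le_optReward [IsProbabilityMeasure D]
    (hD0 : D (Iio 0) = 0) (hD : Integrable (fun x : ℝ => x) D) (hmean : 0 < mean D) {n : ℕ}
    (hn : 46 ≤ n) {A : Policy n} (hA : A.IsNaive) :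
    A.expectedReward D (badNoise D n)
      ≤ 8 * mean D / mean (maxLaw D n) * optReward D (badNoise D n) := by
  have hM := mean_maxLaw_pos hD0 hD hmean hn
  have h1 := hA.expectedReward_badNoise_le hD0 hD hmean hn
  have h2 := mean_maxLaw_le_two_mul_optReward hD0 hD hmean hn
  refine h1.trans ?_
  rw [div_mul_eq_mul_div, le_div_iff₀ hM]
  nlinarith

/-! ### The Bernoulli example. -/

/-- The Bernoulli distribution with mean `1 / n`. -/
noncomputable def rareLaw (n : ℕ) : Measure ℝ :=
  ENNReal.ofReal (1 - 1 / n) • Measure.dirac 0 + ENNReal.ofReal (1 / n) • Measure.dirac 1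

lemma isProbabilityMeasure_rareLaw {n : ℕ} (hn : 1 ≤ n) : IsProbabilityMeasure (rareLaw n) := by
  have h1 : (1 : ℝ) / n ≤ 1 := by
    rw [div_le_one (by positivity)]; exact_mod_cast hn
  constructor
  simp only [rareLaw, Measure.coe_add, Measure.coe_smul, Pi.add_apply, Pi.smul_apply, measure_univ,
    smul_eq_mul, mul_one]
  rw [← ENNReal.ofReal_add (by linarith) (by positivity)]
  simp

lemma ae_rareLaw (n : ℕ) : ∀ᵐ x ∂(rareLaw n), x = 0 ∨ x = 1 := by
  rw [rareLaw, ae_add_measure_iff]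
  exact ⟨Measure.ae_smul_measure (by simp) _, Measure.ae_smul_measure (by simp) _⟩

lemma integrable_rareLaw (n : ℕ) (f : ℝ → ℝ) : Integrable f (rareLaw n) :=
  ((integrable_dirac (by simp)).smul_measure ENNReal.ofReal_ne_top).add_measure
    ((integrable_dirac (by simp)).smul_measure ENNReal.ofReal_ne_top)

lemma integral_rareLaw {n : ℕ} (hn : 1 ≤ n) (f : ℝ → ℝ) :
    ∫ x, f x ∂(rareLaw n) = (1 - 1 / n) * f 0 + 1 / n * f 1 := by
  have h1 : (1 : ℝ) / n ≤ 1 := by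
    rw [div_le_one (by positivity)]; exact_mod_cast hn
  rw [rareLaw, integral_add_measure
    ((integrable_dirac (by simp)).smul_measure ENNReal.ofReal_ne_top)
    ((integrable_dirac (by simp)).smul_measure ENNReal.ofReal_ne_top),
    integral_smul_measure, integral_smul_measure, integral_dirac, integral_dirac,
    ENNReal.toReal_ofReal (by linarith), ENNReal.toReal_ofReal (by positivity)]
  rfl

lemma rareLaw_Iio (n : ℕ) : rareLaw n (Iio 0) = 0 :=
  measure_mono_null (fun x hx => by
    have hx' : x < 0 := hx
    rintro (rfl | rfl)
    · exact lt_irrefl _ hx'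
    · linarith) (ae_iff.1 (ae_rareLaw n))

lemma mean_rareLaw {n : ℕ} (hn : 1 ≤ n) : mean (rareLaw n) = 1 / n := by
  rw [mean, integral_rareLaw hn]; ring

/-- For 0-1 values the maximum is 1 - ∏ (1 - x_i), with expectation 1 - (1 - 1/n)^n ≥ 1 - 1/e. -/
lemma half_le_mean_maxLaw_rareLaw {n : ℕ} (hn : 1 ≤ n) :
    1 / 2 ≤ mean (maxLaw (rareLaw n) n) := by
  have := isProbabilityMeasure_rareLaw hn
  have h1 : (1 : ℝ) / n ≤ 1 := by
    rw [div_le_one (by positivity)]; exact_mod_cast hn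
  have hprod : Integrable (fun x : Fin n → ℝ => ∏ i, (1 - x i))
      (Measure.pi fun _ : Fin n => rareLaw n) :=
    Integrable.fintype_prod (f := fun _ y => 1 - y) fun _ => integrable_rareLaw n _
  have hval : ∫ x : Fin n → ℝ, ∏ i, (1 - x i) ∂(Measure.pi fun _ : Fin n => rareLaw n)
      = (1 - 1 / (n : ℝ)) ^ n := by
    rw [integral_fintype_prod_eq_prod (fun (_ : Fin n) y => 1 - y)]
    simp [integral_rareLaw hn]
  have hle : (1 - 1 / (n : ℝ)) ^ n ≤ 1 / 2 := by
    calc (1 - 1 / (n : ℝ)) ^ n ≤ Real.exp (-(1 / n)) ^ n := by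
          refine pow_le_pow_left₀ (by linarith) ?_ n
          linarith [Real.add_one_le_exp (-(1 / (n : ℝ)))]
      _ = Real.exp (-1) := by
          rw [← Real.exp_nat_mul]
          congr 1
          field_simp
      _ ≤ 1 / 2 := by
          rw [Real.exp_neg, ← one_div]
          exact one_div_le_one_div_of_le (by norm_num) (by linarith [Real.add_one_le_exp (1 : ℝ)])
  have hae : ∀ᵐ x ∂(Measure.pi fun _ : Fin n => rareLaw n), ∀ i, x i = 0 ∨ x i = 1 := by
    rw [ae_all_iff]
    exact fun i => (measurePreserving_eval (fun _ : Fin n => rareLaw n) i).quasiMeasurePreserving.ae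
      (ae_rareLaw n)
  have hmono : ∫ x : Fin n → ℝ, (1 - ∏ i, (1 - x i)) ∂(Measure.pi fun _ : Fin n => rareLaw n)
      ≤ mean (maxLaw (rareLaw n) n) := by
    rw [mean_maxLaw]
    refine integral_mono_ae ((integrable_const 1).sub hprod)
      (integrable_max (rareLaw_Iio n) (integrable_rareLaw n _) n) ?_
    filter_upwards [hae] with x hx
    by_cases h : ∃ j, x j = 1
    · obtain ⟨j, hj⟩ := h
      have : ∏ i, (1 - x i) = 0 := Finset.prod_eq_zero (Finset.mem_univ j) (by simp [hj])
      rw [this, sub_zero, ← hj]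
      exact le_max x j
    · push Not at h
      have hx0 : ∀ i, x i = 0 := fun i => (hx i).resolve_right (h i)
      simp [hx0]
  rw [integral_sub (integrable_const 1) hprod, hval] at hmono
  simp only [integral_const, probReal_univ, smul_eq_mul, mul_one] at hmono
  linarith

end NoisyBoxes

theorem mainTheorem4 :
    (∀ (D : Measure ℝ), IsProbabilityMeasure D → D (Set.Iio 0) = 0 →
      Integrable (fun x : ℝ => x) D → 0 < NoisyBoxes.mean D →
      ∀ n : ℕ, 46 ≤ n → ∀ c : ℝ, 0 < c → c ≤ (n - 6 * Real.log n) / n →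
      ∃ σ ∈ NoisyBoxes.smallNoise D n c,
        (∀ i : Fin n, (σ i : ℝ) =
          if (i : ℕ) < n - ⌊6 * Real.log n⌋₊ then 0 else NoisyBoxes.largeNoise D n) ∧
        0 < NoisyBoxes.largeNoise D n ∧
        5 * Real.log n ≤ (Finset.univ.filter fun i : Fin n => 0 < σ i).card ∧
        ((Finset.univ.filter fun i : Fin n => 0 < σ i).card : ℝ) ≤ 6 * Real.log n ∧
        ∀ A : NoisyBoxes.Policy n, A.IsNaive →
          A.expectedReward D σ ≤
            8 * NoisyBoxes.mean D / NoisyBoxes.mean (NoisyBoxes.maxLaw D n) *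
              NoisyBoxes.optReward D σ) ∧
    (∃ κ : ℝ, 0 < κ ∧
      ∀ n : ℕ, 46 ≤ n → ∀ c : ℝ, 0 < c → c ≤ (n - 6 * Real.log n) / n →
      ∃ D : Measure ℝ, IsProbabilityMeasure D ∧ D (Set.Iio 0) = 0 ∧
        Integrable (fun x : ℝ => x) D ∧ 0 < NoisyBoxes.mean D ∧
        ∃ σ ∈ NoisyBoxes.smallNoise D n c, ∀ A : NoisyBoxes.Policy n, A.IsNaive →
          0 < A.expectedReward D σ ∧
          κ * n * A.expectedReward D σ ≤ NoisyBoxes.optReward D σ) := by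
  -- The constant 1/16 compares a naive reward of at most 4/n with an optimum of at least 1/4.
  refine ⟨fun D _ hD0 hD hmean n hn c _ hc => ?_, 1 / 16, by norm_num, fun n hn c _ hc => ?_⟩
  · have hpos := NoisyBoxes.largeNoise_pos hD0 hD hmean hn
    have hcard := NoisyBoxes.card_badNoise_ne_zero (D := D) hn hpos
    have hf := NoisyBoxes.floor_six_mul_log hn
    simp_rw [← pos_iff_ne_zero] at hcard
    refine ⟨NoisyBoxes.badNoise D n, NoisyBoxes.badNoise_mem_smallNoise hD0 hn hc, fun i => ?_,
      hpos, ?_, ?_, fun A hA => hA.expectedReward_badNoise_le_optReward hD0 hD hmean hn⟩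
    · unfold NoisyBoxes.badNoise
      split_ifs
      · rfl
      · exact Real.coe_toNNReal _ hpos.le
    · rw [hcard]; exact hf.1
    · rw [hcard]; exact hf.2.1
  · have hn1 : 1 ≤ n := by omega
    have hn' : (0 : ℝ) < n := by positivity
    have := NoisyBoxes.isProbabilityMeasure_rareLaw hn1
    have hD0 := NoisyBoxes.rareLaw_Iio n
    have hD := NoisyBoxes.integrable_rareLaw n fun x => x
    have hval := NoisyBoxes.mean_rareLaw hn1
    have hmean : 0 < NoisyBoxes.mean (NoisyBoxes.rareLaw n) := by rw [hval]; positivity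
    refine ⟨NoisyBoxes.rareLaw n, this, hD0, hD, hmean, NoisyBoxes.badNoise _ n,
      NoisyBoxes.badNoise_mem_smallNoise hD0 hn hc,
      fun A hA => ⟨A.expectedReward_pos hD0 hD hmean _, ?_⟩⟩
    have h1 := hA.expectedReward_badNoise_le hD0 hD hmean hn
    have h2 := NoisyBoxes.mean_maxLaw_le_two_mul_optReward hD0 hD hmean hn
    have h3 := NoisyBoxes.half_le_mean_maxLaw_rareLaw hn1
    rw [hval, mul_one_div, le_div_iff₀ hn'] at h1
    linarith
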